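/- Let $n\ge 1$, $d\ge 0$, $T\ge 0$ be integers, $\mathcal Z$ a set, and $\ell:\mathbb R^d\times\mathcal Z\to\mathbb R$ a loss such that, for every $z$, $w\mapsto\ell(w,z)$ is differentiable with $\|\nabla_w\ell(w,z)\|_2\le G$ for all $w$, where $G>0$. Let $\beta_0>0$, $0<\delta\le 1$ and $n\delta<2.5$, and set $$\eta_t=\frac{G^{-1}\sqrt{\beta_0}}{\sqrt{8\,\ln\!\big(2.5\,t^2/(n\delta)\big)\,t}}\quad(t\ge 1),\qquad \lambda_t=\frac1{\eta_t}-\frac1{\eta_{t-1}}\quad(t\ge 2).$$ Consider the following algorithm (DP-SGD with batch size $1$, sampling with replacement) on a dataset $S_n=(z_1,\dots,z_n)\in\mathcal Z^n$. Draw $w_1\sim N(0,\beta_0 I)$. For $t=2,\dots,T$, draw an index $i_{t-1}$ uniformly from $\{1,\dots,n\}$, independently of everything before, put $\tilde w_{t-1}=w_{t-1}-\eta_t\nabla_w\ell(w_{t-1},z_{i_{t-1}})$, and draw $$w_t\sim N\big((1-\lambda_t\eta_t)\,\tilde w_{t-1},\ \lambda_t\eta_t(2-\lambda_t\eta_t)\,\beta_0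 I\big).$$ The output is the whole sequence of iterates $(w_1,\dots,w_T)\in(\mathbb R^d)^T$. Then the algorithm is $(\epsilon,\delta)$-differentially private with $$\epsilon=\sqrt{2T\ln(2/\delta)}\;\frac{e}{n}+\frac{T e^2}{n^2},$$ that is, for any two datasets $S_n,S_n'\in\mathcal Z^n$ differing in at most one item and every measurable $E\subseteq(\mathbb R^d)^T$, $$P\big((w_1,\dots,w_T)(S_n)\in E\big)\le e^{\epsilon}\,P\big((w_1,\dots,w_T)(S_n')\in E\big)+\delta .$$ -/

import Mathlib

open MeasureTheory ProbabilityTheory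
open scoped ENNReal

noncomputable section

/-- Two datasets of size `n` are neighbours if they differ in at most one item. -/
def Neighboring {Z : Type*} {n : ℕ} (S S' : Fin n → Z) : Prop :=
  {j | S j ≠ S' j}.Subsingleton

/-- `(ε, δ)`-differential privacy of a randomized algorithm on datasets of size `n`. The algorithm
is given by the law `A S` of its output on the dataset `S`; events are the measurable sets. -/
def IsDP {Z Ω : Type*} [MeasurableSpace Ω] {n : ℕ} (A : (Fin n → Z) → Measure Ω) (ε δ : ℝ) : Prop :=
  ∀ S S' : Fin n → Z, Neighboring S S' → ∀ F : Set Ω, MeasurableSet F →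
    (A S).real F ≤ Real.exp ε * (A S').real F + δ

/-- The normal distribution `N(m, v I)` on `ℝᵈ` (for a variance `v ≥ 0`). -/
def isoGaussian {d : ℕ} (m : EuclideanSpace ℝ (Fin d)) (v : ℝ) :
    Measure (EuclideanSpace ℝ (Fin d)) :=
  (stdGaussian (EuclideanSpace ℝ (Fin d))).map (fun x => m + √v • x)

instance {d : ℕ} (m : EuclideanSpace ℝ (Fin d)) (v : ℝ) : IsProbabilityMeasure (isoGaussian m v) :=
  Measure.isProbabilityMeasure_map (by fun_prop)

lemma measurable_isoGaussian {X : Type*} [MeasurableSpace X] {d : ℕ}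
    {f : X → EuclideanSpace ℝ (Fin d)} (hf : Measurable f) (v : ℝ) :
    Measurable fun x => isoGaussian (f x) v := by
  have hg : Measurable fun p : X × EuclideanSpace ℝ (Fin d) => f p.1 + √v • p.2 := by
    fun_prop
  refine Measure.measurable_of_measurable_coe _ fun s hs => ?_
  have h : (fun x => isoGaussian (f x) v s) = fun x => stdGaussian (EuclideanSpace ℝ (Fin d))
      (Prod.mk x ⁻¹' ((fun p : X × EuclideanSpace ℝ (Fin d) => f p.1 + √v • p.2) ⁻¹' s)) := by
    funext x
    rw [isoGaussian, Measure.map_apply (by fun_prop) hs, Set.preimage_preimage]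
  rw [h]
  exact measurable_measure_prodMk_left (hg hs)

lemma measurable_gradient {d : ℕ} (f : EuclideanSpace ℝ (Fin d) → ℝ) : Measurable (gradient f) :=
  (InnerProductSpace.toDual ℝ (EuclideanSpace ℝ (Fin d))).symm.continuous.measurable.comp
    (measurable_fderiv ℝ f)

/-- One noisy stochastic gradient step with batch size `1`, as a transition kernel on `ℝᵈ`: from
`w`, an index `i` is drawn uniformly from the `n` data indices, the gradient step
`w̃ = w - η ∇ℓ(w, zᵢ)` is taken, and the new point is drawn from
`N((1 - λ η) w̃, λ η (2 - λ η) β₀ I)`. The parameter `lam` is `λ`. -/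
def sgldStep {Z : Type*} {n d : ℕ} (ℓ : EuclideanSpace ℝ (Fin d) → Z → ℝ) (η lam β₀ : ℝ)
    (S : Fin n → Z) : Kernel (EuclideanSpace ℝ (Fin d)) (EuclideanSpace ℝ (Fin d)) where
  toFun w := ∑ i : Fin n, (n : ℝ≥0∞)⁻¹ •
    isoGaussian ((1 - lam * η) • (w - η • gradient (fun u => ℓ u (S i)) w))
      (lam * η * (2 - lam * η) * β₀)
  measurable' := by
    refine Measure.measurable_of_measurable_coe _ fun s hs => ?_
    simp only [Measure.coe_finsetSum, Finset.sum_apply, Measure.smul_apply, smul_eq_mul]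
    refine Finset.measurable_fun_sum _ fun i _ => Measurable.const_mul ?_ _
    exact (Measure.measurable_coe hs).comp (measurable_isoGaussian
      ((measurable_id.sub ((measurable_gradient _).const_smul η)).const_smul (1 - lam * η)) _)

instance {Z : Type*} {n d : ℕ} [NeZero n] (ℓ : EuclideanSpace ℝ (Fin d) → Z → ℝ)
    (η lam β₀ : ℝ) (S : Fin n → Z) : IsMarkovKernel (sgldStep ℓ η lam β₀ S) where
  isProbabilityMeasure w := ⟨by
    change (∑ i : Fin n, (n : ℝ≥0∞)⁻¹ • isoGaussian _ _) Set.univ = 1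
    simp [ENNReal.mul_inv_cancel (Nat.cast_ne_zero.2 (NeZero.ne n)) (ENNReal.natCast_ne_top n)]⟩

/-- Conditional law of the iterate `w_{t+1}` given the previous iterates `(w_1, …, w_t)`.
The first iterate is drawn from `N(0, β₀ I)`; the iterate `w_{s+2}` is obtained from `w_{s+1}`
(the last entry of the history) by a step with parameters `η_{s+2}` and `λ_{s+2}`. -/
def sgldNext {Z : Type*} {n d : ℕ} (ℓ : EuclideanSpace ℝ (Fin d) → Z → ℝ) (η lam : ℕ → ℝ)
    (β₀ : ℝ) (S : Fin n → Z) :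
    (t : ℕ) → Kernel (Fin t → EuclideanSpace ℝ (Fin d)) (EuclideanSpace ℝ (Fin d))
  | 0 => Kernel.const _ (isoGaussian 0 β₀)
  | s + 1 => (sgldStep ℓ (η (s + 2)) (lam (s + 2)) β₀ S).comap (fun h => h (Fin.last s))
      (measurable_pi_apply _)

instance {Z : Type*} {n d : ℕ} [NeZero n] (ℓ : EuclideanSpace ℝ (Fin d) → Z → ℝ) (η lam : ℕ → ℝ)
    (β₀ : ℝ) (S : Fin n → Z) : (t : ℕ) → IsMarkovKernel (sgldNext ℓ η lam β₀ S t)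
  | 0 => by unfold sgldNext; infer_instance
  | s + 1 => by unfold sgldNext; infer_instance

/-- Joint law of the iterates `(w_1, …, w_T)` of the noisy stochastic gradient method with batch
size `1` run on the dataset `S`; the coordinate `t : Fin T` is the iterate `w_{t+1}`. The sampled
indices and the Gaussian noises of different steps are independent. -/
def sgldLaw {Z : Type*} {n d : ℕ} (ℓ : EuclideanSpace ℝ (Fin d) → Z → ℝ) (η lam : ℕ → ℝ)
    (β₀ : ℝ) : (T : ℕ) → (Fin n → Z) → Measure (Fin T → EuclideanSpace ℝ (Fin d))
  | 0, _ => Measure.dirac Fin.elim0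
  | t + 1, S => (sgldLaw ℓ η lam β₀ t S ⊗ₘ sgldNext ℓ η lam β₀ S t).map
      fun p => Fin.snoc (α := fun _ => EuclideanSpace ℝ (Fin d)) p.1 p.2

lemma measurable_fin_snoc {X : Type*} [MeasurableSpace X] (t : ℕ) :
    Measurable fun p : (Fin t → X) × X => (Fin.snoc (α := fun _ => X) p.1 p.2 : Fin (t + 1) → X) := by
  refine measurable_pi_lambda _ fun i => ?_
  refine Fin.lastCases ?_ (fun j => ?_) i
  · simpa using measurable_snd
  · simpa [Function.comp_def] using (measurable_pi_apply (X := fun _ : Fin t => X) j).comp measurable_fst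

instance isProbabilityMeasure_sgldLaw {Z : Type*} {n d : ℕ} [NeZero n]
    (ℓ : EuclideanSpace ℝ (Fin d) → Z → ℝ) (η lam : ℕ → ℝ) (β₀ : ℝ) :
    (T : ℕ) → (S : Fin n → Z) → IsProbabilityMeasure (sgldLaw ℓ η lam β₀ T S)
  | 0, _ => by unfold sgldLaw; infer_instance
  | t + 1, S => by
    have := isProbabilityMeasure_sgldLaw ℓ η lam β₀ t S
    exact Measure.isProbabilityMeasure_map (measurable_fin_snoc t).aemeasurable

end

/-! Condition on the iterates produced so far. The next iterate then follows a uniform mixture of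
Gaussians with a common variance, and neighbouring datasets change only one component `j`. With
respect to the second mixture, the first has density `1 + (A - B) / n`, where `A` and `B` are the
relative densities of the old and new component `j`.

The ratio is unbounded, so `A` is cut at `e`. By `lintegral_excess_le` the lost part costs at most
`5/4 * exp (-L) / n`, with `L` the logarithm in the step size; over all steps this telescopes to `δ
/ 2`. What remains lies in `[0, 1 + s]`, `s = e / n`, has mean at most `1` and mean square deviation
from `1` at most `s ^ 2`. A Bennett-type inequality (`integral_rpow_one_add_le`) bounds its moment
of order `1 + a` by `exp (a s ^ 2 + (a s) ^ 2 / 2)`.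

Along the sequence, errors add and moments multiply (`sgldLaw_comparison`). Markov's inequality with
the optimal `a` (`measure_le_of_moment_bound`) yields the other `δ / 2`. The schedule enters only
through `schedule_noise_bound`: squared distances between component means are at most `v / (2 L)`.
-/

/-! ### Gaussian integrals and density ratios. -/

-- A joint Laplace–Fourier transform: it supplies both the exponential moments and the
-- characteristic function of the tilted Gaussian in the Cameron–Martin formula. It factors over
-- coordinates into one-dimensional complex moment generating functions.
open scoped RealInnerProductSpace in
lemma integral_cexp_stdGaussian {E : Type*} [NormedAddCommGroup E] [InnerProductSpace ℝ E]
    [FiniteDimensional ℝ E] [MeasurableSpace E] [BorelSpace E] (h t : E) :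
    ∫ x, Complex.exp (⟪x, h⟫ + ⟪x, t⟫ * Complex.I) ∂(stdGaussian E) =
      Complex.exp ((‖h‖ ^ 2 - ‖t‖ ^ 2) / 2 + ⟪h, t⟫ * Complex.I) := by
  rw [stdGaussian, integral_map (Measurable.aemeasurable (by fun_prop))
    (Measurable.aestronglyMeasurable (by fun_prop))]
  have key : ∀ x : Fin (Module.finrank ℝ E) → ℝ,
      Complex.exp ((⟪∑ i, x i • stdOrthonormalBasis ℝ E i, h⟫ : ℝ) +
        (⟪∑ i, x i • stdOrthonormalBasis ℝ E i, t⟫ : ℝ) * Complex.I) =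
      ∏ i, Complex.exp (((⟪stdOrthonormalBasis ℝ E i, h⟫ : ℝ) +
        (⟪stdOrthonormalBasis ℝ E i, t⟫ : ℝ) * Complex.I) * (x i : ℂ)) := by
    intro x
    rw [← Complex.exp_sum, sum_inner, sum_inner]
    congr 1
    push_cast
    rw [Finset.sum_mul, ← Finset.sum_add_distrib]
    refine Finset.sum_congr rfl fun i _ => ?_
    simp only [real_inner_smul_left]
    push_cast
    ring
  simp_rw [key]
  rw [integral_fintype_prod_eq_prod (f := fun i (y : ℝ) =>
    Complex.exp (((⟪stdOrthonormalBasis ℝ E i, h⟫ : ℝ) +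
        (⟪stdOrthonormalBasis ℝ E i, t⟫ : ℝ) * Complex.I) * (y : ℂ)))]
  have hm : ∀ z : ℂ, ∫ y : ℝ, Complex.exp (z * y) ∂(gaussianReal 0 1) = Complex.exp (z ^ 2 / 2) := by
    intro z
    have := complexMGF_id_gaussianReal (μ := 0) (v := 1) z
    simpa [complexMGF] using this
  simp_rw [hm, ← Complex.exp_sum]
  congr 1
  have h1 := (stdOrthonormalBasis ℝ E).sum_sq_inner_right h
  have h2 := (stdOrthonormalBasis ℝ E).sum_sq_inner_right t
  have h3 := (stdOrthonormalBasis ℝ E).sum_inner_mul_inner h t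
  rw [← Complex.ofReal_pow, ← Complex.ofReal_pow, ← h1, ← h2, ← h3]
  push_cast
  rw [← Finset.sum_sub_distrib, Finset.sum_div, Finset.sum_mul, ← Finset.sum_add_distrib]
  refine Finset.sum_congr rfl fun i _ => ?_
  rw [real_inner_comm (stdOrthonormalBasis ℝ E i) h]
  ring_nf
  rw [Complex.I_sq]
  ring

open scoped RealInnerProductSpace in
lemma integral_exp_inner_stdGaussian {E : Type*} [NormedAddCommGroup E] [InnerProductSpace ℝ E]
    [FiniteDimensional ℝ E] [MeasurableSpace E] [BorelSpace E] (h : E) :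
    ∫ x, Real.exp ⟪h, x⟫ ∂(stdGaussian E) = Real.exp (‖h‖ ^ 2 / 2) := by
  have := integral_cexp_stdGaussian h (0 : E)
  simp only [inner_zero_right, Complex.ofReal_zero, zero_mul, add_zero, norm_zero] at this
  have h2 : ∫ x, Complex.exp ((⟪x, h⟫ : ℝ) : ℂ) ∂(stdGaussian E) =
      ((∫ x, Real.exp ⟪h, x⟫ ∂(stdGaussian E) : ℝ) : ℂ) := by
    rw [← integral_complex_ofReal]
    simp [real_inner_comm h]
  rw [h2] at this
  apply Complex.ofReal_injective
  rw [this]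
  push_cast
  simp

open scoped RealInnerProductSpace in
lemma lintegral_exp_inner_stdGaussian {E : Type*} [NormedAddCommGroup E] [InnerProductSpace ℝ E]
    [FiniteDimensional ℝ E] [MeasurableSpace E] [BorelSpace E] (h : E) :
    ∫⁻ x, ENNReal.ofReal (Real.exp ⟪h, x⟫) ∂(stdGaussian E) =
      ENNReal.ofReal (Real.exp (‖h‖ ^ 2 / 2)) := by
  rw [← integral_exp_inner_stdGaussian, ofReal_integral_eq_lintegral_ofReal]
  -- Integrability comes for free: a non-integrable function would have integral `0`, but the value
  -- is positive.
  · refine not_imp_comm.1 integral_undef ?_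
    rw [integral_exp_inner_stdGaussian]
    positivity
  · exact .of_forall fun x => (Real.exp_pos _).le

open scoped RealInnerProductSpace in
/-- The Cameron–Martin formula in finite dimension. -/
lemma map_add_stdGaussian {E : Type*} [NormedAddCommGroup E] [InnerProductSpace ℝ E]
    [FiniteDimensional ℝ E] [MeasurableSpace E] [BorelSpace E] (h : E) :
    (stdGaussian E).map (fun x => h + x) = (stdGaussian E).withDensity
      (fun x => ENNReal.ofReal (Real.exp (⟪h, x⟫ - ‖h‖ ^ 2 / 2))) := by
  have hmass : ∫⁻ x, ENNReal.ofReal (Real.exp (⟪h, x⟫ - ‖h‖ ^ 2 / 2)) ∂(stdGaussian E) = 1 := by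
    simp_rw [Real.exp_sub, div_eq_mul_inv, ENNReal.ofReal_mul (Real.exp_pos _).le]
    rw [lintegral_mul_const _ (by fun_prop), lintegral_exp_inner_stdGaussian,
      ← ENNReal.ofReal_mul (Real.exp_pos _).le, div_eq_mul_inv,
      mul_inv_cancel₀ (Real.exp_pos _).ne', ENNReal.ofReal_one]
  have : IsProbabilityMeasure ((stdGaussian E).map (fun x => h + x)) :=
    Measure.isProbabilityMeasure_map (by fun_prop)
  have : IsProbabilityMeasure ((stdGaussian E).withDensity
      (fun x => ENNReal.ofReal (Real.exp (⟪h, x⟫ - ‖h‖ ^ 2 / 2)))) :=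
    ⟨by rw [withDensity_apply _ .univ, Measure.restrict_univ, hmass]⟩
  apply Measure.ext_of_charFun
  ext t
  rw [charFun_apply, charFun_apply, integral_map (by fun_prop) (by fun_prop),
    integral_withDensity_eq_integral_toReal_smul (by fun_prop) (by simp)]
  have hl : ∀ x, Complex.exp ((⟪h + x, t⟫ : ℝ) * Complex.I) =
      Complex.exp ((⟪h, t⟫ : ℝ) * Complex.I) * Complex.exp (((⟪x, 0⟫ : ℝ) : ℂ) +
        (⟪x, t⟫ : ℝ) * Complex.I) := by
    intro x
    rw [← Complex.exp_add, inner_add_left]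
    simp [add_mul]
  have hr : ∀ x, (ENNReal.ofReal (Real.exp (⟪h, x⟫ - ‖h‖ ^ 2 / 2))).toReal •
      Complex.exp ((⟪x, t⟫ : ℝ) * Complex.I) = Complex.exp (-(‖h‖ ^ 2 / 2 : ℝ)) *
      Complex.exp (((⟪x, h⟫ : ℝ) : ℂ) + (⟪x, t⟫ : ℝ) * Complex.I) := by
    intro x
    rw [ENNReal.toReal_ofReal (Real.exp_pos _).le, Complex.real_smul, Complex.ofReal_exp,
      ← Complex.exp_add, ← Complex.exp_add, real_inner_comm h x]
    congr 1
    push_cast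
    ring
  simp_rw [hl, hr]
  rw [integral_const_mul, integral_const_mul, integral_cexp_stdGaussian,
    integral_cexp_stdGaussian, ← Complex.exp_add, ← Complex.exp_add]
  congr 1
  simp
  ring

noncomputable section

open scoped RealInnerProductSpace in
/-- Density of `N(m, v I)` with respect to `N(0, v I)`. -/
def gaussianRatio {d : ℕ} (v : ℝ) (m x : EuclideanSpace ℝ (Fin d)) : ℝ :=
  Real.exp ((⟪m, x⟫ - ‖m‖ ^ 2 / 2) / v)

lemma gaussianRatio_pos {d : ℕ} (v : ℝ) (m x : EuclideanSpace ℝ (Fin d)) :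
    0 < gaussianRatio v m x := Real.exp_pos _

@[fun_prop]
lemma Measurable.gaussianRatio {X : Type*} [MeasurableSpace X] {d : ℕ} (v : ℝ)
    {f g : X → EuclideanSpace ℝ (Fin d)} (hf : Measurable f) (hg : Measurable g) :
    Measurable fun x => gaussianRatio v (f x) (g x) := by
  unfold _root_.gaussianRatio
  fun_prop

lemma isoGaussian_eq_withDensity {d : ℕ} {v : ℝ} (hv : 0 < v) (m : EuclideanSpace ℝ (Fin d)) :
    isoGaussian m v =
      (isoGaussian 0 v).withDensity fun x => ENNReal.ofReal (gaussianRatio v m x) := by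
  have hs : 0 < √v := Real.sqrt_pos.2 hv
  ext s hs'
  have hmeas : Measurable fun x : EuclideanSpace ℝ (Fin d) =>
      (0 : EuclideanSpace ℝ (Fin d)) + √v • x := by
    fun_prop
  rw [withDensity_apply _ hs', isoGaussian, isoGaussian,
    setLIntegral_map hs' (by fun_prop) hmeas, Measure.map_apply (by fun_prop) hs']
  -- Shifting by `m` after scaling is scaling after a shift by `m / √v`, to which Cameron–Martin
  -- applies.
  have h1 : (fun x : EuclideanSpace ℝ (Fin d) => m + √v • x) =
      (fun x => 0 + √v • x) ∘ (fun x => (√v)⁻¹ • m + x) := by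
    funext x
    simp [smul_smul, hs.ne']
  rw [h1, Set.preimage_comp, ← Measure.map_apply (by fun_prop) (hmeas hs'), map_add_stdGaussian,
    withDensity_apply _ (hmeas hs')]
  congr 1
  funext x
  congr 2
  rw [real_inner_smul_left, norm_smul, zero_add, real_inner_smul_right, norm_inv,
    Real.norm_of_nonneg hs.le]
  have hsq := Real.sq_sqrt hv.le
  generalize √v = r at hs hsq ⊢
  subst hsq
  field_simp

open scoped RealInnerProductSpace in
lemma lintegral_exp_inner_isoGaussian {d : ℕ} {v : ℝ} (hv : 0 < v)
    (h : EuclideanSpace ℝ (Fin d)) :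
    ∫⁻ x, ENNReal.ofReal (Real.exp ⟪h, x⟫) ∂(isoGaussian 0 v) =
      ENNReal.ofReal (Real.exp (v * ‖h‖ ^ 2 / 2)) := by
  rw [isoGaussian, lintegral_map (by fun_prop) (by fun_prop)]
  have := lintegral_exp_inner_stdGaussian (√v • h)
  rw [norm_smul, mul_pow, Real.norm_eq_abs, sq_abs, Real.sq_sqrt hv.le] at this
  rw [← this]
  simp [real_inner_smul_left, real_inner_smul_right]

open scoped RealInnerProductSpace in
/-- Rényi-type integral of two Gaussians with the same covariance. -/
lemma lintegral_gaussianRatio_rpow {d : ℕ} {v : ℝ} (hv : 0 < v)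
    (m m' : EuclideanSpace ℝ (Fin d)) (k : ℝ) :
    ∫⁻ x, ENNReal.ofReal (gaussianRatio v m x ^ (k + 1) * gaussianRatio v m' x ^ (-k))
      ∂(isoGaussian 0 v) = ENNReal.ofReal (Real.exp (k * (k + 1) * ‖m - m'‖ ^ 2 / (2 * v))) := by
  have key : ∀ x, gaussianRatio v m x ^ (k + 1) * gaussianRatio v m' x ^ (-k) =
      Real.exp ⟪v⁻¹ • ((k + 1) • m - k • m'), x⟫ *
        Real.exp (-((k + 1) * ‖m‖ ^ 2 - k * ‖m'‖ ^ 2) / (2 * v)) := by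
    intro x
    rw [gaussianRatio, gaussianRatio, ← Real.exp_mul, ← Real.exp_mul, ← Real.exp_add,
      ← Real.exp_add, real_inner_smul_left, inner_sub_left, real_inner_smul_left,
      real_inner_smul_left]
    congr 1
    field_simp
    ring
  simp_rw [key, ENNReal.ofReal_mul (Real.exp_pos _).le]
  rw [lintegral_mul_const _ (by fun_prop), lintegral_exp_inner_isoGaussian hv,
    ← ENNReal.ofReal_mul (Real.exp_pos _).le, ← Real.exp_add]
  congr 2
  rw [norm_smul, mul_pow, Real.norm_eq_abs, sq_abs, norm_sub_sq_real, norm_sub_sq_real,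
    norm_smul, norm_smul, real_inner_smul_left, real_inner_smul_right, mul_pow, mul_pow,
    Real.norm_eq_abs, Real.norm_eq_abs, sq_abs, sq_abs]
  field_simp
  ring

end

/-! ### Scalar inequalities and the moment bound. -/

lemma hasSum_exp_sub_one_sub (x : ℝ) :
    HasSum (fun k : ℕ => x ^ (k + 2) / (k + 2).factorial) (Real.exp x - 1 - x) := by
  have h : HasSum (fun k : ℕ => x ^ k / k.factorial) (Real.exp x) := by
    rw [Real.exp_eq_exp_ℝ]
    exact NormedSpace.expSeries_div_hasSum_exp x
  have := (hasSum_nat_add_iff' 2).2 h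
  simpa [Finset.sum_range_succ, sub_sub] using this

lemma exp_le_one_add_add_sq_half {y : ℝ} (hy : y ≤ 0) : Real.exp y ≤ 1 + y + y ^ 2 / 2 := by
  have h := Real.quadratic_le_exp_of_nonneg (x := -y) (by linarith)
  have h0 : Real.exp y * Real.exp (-y) = 1 := by rw [← Real.exp_add]; simp
  have h1 : 0 < 1 + y + y ^ 2 / 2 := by nlinarith [sq_nonneg (y + 1)]
  refine le_of_mul_le_mul_right ?_ (Real.exp_pos (-y))
  rw [h0]
  refine le_trans ?_ (mul_le_mul_of_nonneg_left h h1.le)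
  -- `(1 + y + y²/2)(1 - y + y²/2) = 1 + y⁴/4`.
  nlinarith [sq_nonneg (y ^ 2)]

/-- Bennett's inequality: `(exp y - 1 - y) / y ^ 2` is increasing. For `y ≥ 0` compare power series;
for `y ≤ 0` the factor `1/2` already suffices. -/
lemma exp_le_one_add_add_sq_mul {y b : ℝ} (hb : 0 < b) (hy : y ≤ b) :
    Real.exp y ≤ 1 + y + y ^ 2 * ((Real.exp b - 1 - b) / b ^ 2) := by
  rcases le_total y 0 with h | h
  · have h1 := Real.quadratic_le_exp_of_nonneg hb.le
    have h2 : 1 / 2 ≤ (Real.exp b - 1 - b) / b ^ 2 := by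
      rw [le_div_iff₀ (by positivity)]
      linarith
    have h3 := mul_le_mul_of_nonneg_left h2 (sq_nonneg y)
    linarith [exp_le_one_add_add_sq_half h]
  · have key : Real.exp y - 1 - y ≤ (y / b) ^ 2 * (Real.exp b - 1 - b) := by
      refine hasSum_le (fun k => ?_) (hasSum_exp_sub_one_sub y)
        ((hasSum_exp_sub_one_sub b).mul_left _)
      rw [← mul_div_assoc]
      gcongr
      have h1 : y ^ k ≤ b ^ k := by gcongr
      have : (y / b) ^ 2 * b ^ (k + 2) = y ^ 2 * b ^ k := by
        rw [div_pow, pow_add]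
        field_simp
      rw [this, pow_add, mul_comm]
      gcongr
    have : (y / b) ^ 2 * (Real.exp b - 1 - b) = y ^ 2 * ((Real.exp b - 1 - b) / b ^ 2) := by
      field_simp
    linarith

/-- With `x = exp (2w)` this is `w ^ 2 ≤ sinh w ^ 2`. -/
lemma mul_log_sq_le {x : ℝ} (hx : 0 < x) : x * Real.log x ^ 2 ≤ (x - 1) ^ 2 := by
  obtain ⟨w, rfl⟩ : ∃ w, x = Real.exp (2 * w) :=
    ⟨Real.log x / 2, by rw [mul_div_cancel₀ _ two_ne_zero, Real.exp_log hx]⟩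
  have hw : w ^ 2 ≤ Real.sinh w ^ 2 := by
    rcases le_total 0 w with h | h
    · have := Real.self_le_sinh_iff.2 h
      nlinarith
    · have := Real.sinh_le_self_iff.2 h
      nlinarith
  have h1 : Real.exp (2 * w) - 1 = Real.exp w * (2 * Real.sinh w) := by
    rw [Real.sinh_eq, two_mul, Real.exp_add, Real.exp_neg]
    have := Real.exp_pos w
    field_simp
  rw [Real.log_exp, h1, mul_pow, two_mul, Real.exp_add, ← sq]
  have := sq_nonneg (Real.exp w)
  nlinarith [mul_le_mul_of_nonneg_left hw this]

lemma sinh_le_mul_cosh {x : ℝ} (hx : 0 ≤ x) : Real.sinh x ≤ x * Real.cosh x := by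
  have h : MonotoneOn (fun y => y * Real.cosh y - Real.sinh y) (Set.Ici 0) := by
    refine monotoneOn_of_deriv_nonneg (convex_Ici 0) (by fun_prop) (by fun_prop) fun y hy => ?_
    rw [interior_Ici] at hy
    have hd : HasDerivAt (fun y => y * Real.cosh y - Real.sinh y)
        (1 * Real.cosh y + y * Real.sinh y - Real.cosh y) y :=
      ((hasDerivAt_id y).mul (Real.hasDerivAt_cosh y)).sub (Real.hasDerivAt_sinh y)
    rw [hd.deriv]
    have := mul_nonneg (le_of_lt hy) (Real.sinh_nonneg_iff.2 (le_of_lt hy))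
    linarith
  have := h (Set.mem_Ici.2 le_rfl) (Set.mem_Ici.2 hx) hx
  simp at this
  linarith

lemma cosh_add_mul_sinh_le {s θ : ℝ} (hs : 0 ≤ s) (hθ : 0 ≤ θ) :
    Real.cosh θ + s * Real.sinh θ ≤ Real.exp (θ * s + θ ^ 2 / 2) := by
  have h1 := sinh_le_mul_cosh hθ
  have h2 := Real.cosh_le_exp_half_sq θ
  have h3 := Real.add_one_le_exp (θ * s)
  have h4 := Real.cosh_pos θ
  rw [Real.exp_add]
  calc Real.cosh θ + s * Real.sinh θ ≤ (θ * s + 1) * Real.cosh θ := by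
        nlinarith [mul_le_mul_of_nonneg_left h1 hs]
    _ ≤ _ := by gcongr

/-- A quadratic upper bound for powers on `[0, 1 + s]`, with coefficients expressed by hyperbolic
functions of `θ = lam * s`. -/
lemma rpow_one_add_le_quadratic {s lam x : ℝ} (hs : 0 < s) (hlam : 0 < lam)
    (hx0 : 0 ≤ x) (hxs : x ≤ 1 + s) {C : ℝ}
    (hCdef : C = (Real.sinh (lam * s) - lam * s * Real.exp (-(lam * s))) / 2 / s ^ 2) :
    x ^ (1 + lam) ≤ (Real.cosh (lam * s) - C * s ^ 2) * x
      + Real.sinh (lam * s) / s * (x * (x - 1)) + C * (x - 1) ^ 2 := by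
  set θ := lam * s with hθ
  have hθ0 : 0 < θ := by positivity
  have hsinh := Real.self_le_sinh_iff.2 hθ0.le
  have hexp : Real.exp (-θ) ≤ 1 := Real.exp_le_one_iff.2 (by linarith)
  have hC : 0 ≤ C := by
    rw [hCdef]
    have : θ * Real.exp (-θ) ≤ θ := mul_le_of_le_one_right hθ0.le hexp
    apply div_nonneg _ (sq_nonneg s)
    linarith
  rcases hx0.eq_or_lt with rfl | hx
  · rw [Real.zero_rpow (by positivity)]
    simpa using hC
  set z := Real.log x with hz
  have hzs : z ≤ s := by
    have := Real.log_le_sub_one_of_pos hx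
    linarith
  have h1 := exp_le_one_add_add_sq_mul (y := lam * z + θ) (b := 2 * θ) (by positivity)
    (by nlinarith)
  -- As a function of `z`, the right side is the quadratic agreeing with `exp (lam * z)` at `z = ±s`
  -- and tangent to it at `-s`; tangency determines `C`.
  have h2 : Real.exp (lam * z) ≤ (Real.cosh θ - C * s ^ 2) + Real.sinh θ / s * z + C * z ^ 2 := by
    have e0 : Real.exp (lam * z) = Real.exp (-θ) * Real.exp (lam * z + θ) := by
      rw [← Real.exp_add]; congr 1; ring
    rw [e0]
    refine (mul_le_mul_of_nonneg_left h1 (Real.exp_pos _).le).trans (le_of_eq ?_)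
    have e1 : Real.exp (-θ) * Real.exp (2 * θ) = Real.exp θ := by
      rw [← Real.exp_add]; congr 1; ring
    rw [hCdef, Real.sinh_eq, Real.cosh_eq, hθ]
    rw [hθ] at e1
    have e2 : Real.exp (-(lam * s)) * (1 + (lam * z + lam * s) + (lam * z + lam * s) ^ 2 *
        ((Real.exp (2 * (lam * s)) - 1 - 2 * (lam * s)) / (2 * (lam * s)) ^ 2)) =
        Real.exp (-(lam * s)) * (1 + (lam * z + lam * s)) + (lam * z + lam * s) ^ 2 *
        ((Real.exp (lam * s) - Real.exp (-(lam * s)) - 2 * (lam * s) * Real.exp (-(lam * s)))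
          / (2 * (lam * s)) ^ 2) := by
      rw [← e1]; ring
    rw [e2]
    field_simp
    ring
  have e3 : x ^ (1 + lam) = x * Real.exp (lam * z) := by
    rw [Real.rpow_add hx, Real.rpow_one, Real.rpow_def_of_pos hx, mul_comm lam]
  rw [e3]
  have h3 := mul_log_sq_le hx
  have h4 : x * z ≤ x * (x - 1) := mul_le_mul_of_nonneg_left (Real.log_le_sub_one_of_pos hx) hx.le
  have h5 : 0 ≤ Real.sinh θ / s := div_nonneg (by linarith) hs.le
  have := mul_le_mul_of_nonneg_left h2 hx.le
  have h6 := mul_le_mul_of_nonneg_left h4 h5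
  have h7 := mul_le_mul_of_nonneg_left h3 hC
  nlinarith

/-- Integrating the quadratic bound, the two `C * s ^ 2` terms cancel and `cosh θ + s * sinh θ` is
left. -/
lemma integral_rpow_one_add_le {X : Type*} [MeasurableSpace X] {Q : Measure X}
    [IsProbabilityMeasure Q] {g : X → ℝ} {s lam : ℝ} (hs : 0 < s) (hlam : 0 < lam)
    (hg : MemLp g 2 Q) (hg0 : ∀ x, 0 ≤ g x) (hgs : ∀ x, g x ≤ 1 + s)
    (h1 : ∫ x, g x ∂Q ≤ 1) (h2 : ∫ x, (g x - 1) ^ 2 ∂Q ≤ s ^ 2) :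
    ∫⁻ x, ENNReal.ofReal (g x ^ (1 + lam)) ∂Q ≤
      ENNReal.ofReal (Real.exp (lam * s * s + (lam * s) ^ 2 / 2)) := by
  set θ := lam * s with hθ
  have hθ0 : 0 < θ := by positivity
  set C := (Real.sinh θ - θ * Real.exp (-θ)) / 2 / s ^ 2 with hC
  have hi := hg.integrable one_le_two
  have hi2 := (hg.sub (memLp_const 1)).integrable_sq
  simp only [Pi.sub_apply] at hi2
  have hb : ∀ x, g x ^ (1 + lam) ≤ (Real.cosh θ - C * s ^ 2 + Real.sinh θ / s) * g x +
      (-(Real.sinh θ / s)) + (Real.sinh θ / s + C) * (g x - 1) ^ 2 := by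
    intro x
    refine (rpow_one_add_le_quadratic hs hlam (hg0 x) (hgs x) hC).trans (le_of_eq ?_)
    ring
  have hsinh := Real.self_le_sinh_iff.2 hθ0.le
  have hexp : Real.exp (-θ) ≤ 1 := Real.exp_le_one_iff.2 (by linarith)
  have hC0 : 0 ≤ C := by
    have : θ * Real.exp (-θ) ≤ θ := mul_le_of_le_one_right hθ0.le hexp
    apply div_nonneg _ (sq_nonneg s)
    linarith
  have hCs : C * s ^ 2 = (Real.sinh θ - θ * Real.exp (-θ)) / 2 := by
    rw [hC]; field_simp
  -- The coefficient of `g` must be nonnegative because its mean is only known to be at most `1`: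
  -- truncation loses mass.
  have hC1 : 0 ≤ Real.cosh θ - C * s ^ 2 := by
    rw [hCs]
    have := Real.sinh_lt_cosh (x := θ)
    have := mul_nonneg hθ0.le (Real.exp_pos (-θ)).le
    linarith
  have h5 : 0 ≤ Real.sinh θ / s := div_nonneg (by linarith) hs.le
  have hint : Integrable (fun x => (Real.cosh θ - C * s ^ 2 + Real.sinh θ / s) * g x +
      (-(Real.sinh θ / s)) + (Real.sinh θ / s + C) * (g x - 1) ^ 2) Q :=
    ((hi.const_mul _).add (integrable_const _)).add (hi2.const_mul _)
  calc ∫⁻ x, ENNReal.ofReal (g x ^ (1 + lam)) ∂Q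
      ≤ ∫⁻ x, ENNReal.ofReal ((Real.cosh θ - C * s ^ 2 + Real.sinh θ / s) * g x +
      (-(Real.sinh θ / s)) + (Real.sinh θ / s + C) * (g x - 1) ^ 2) ∂Q :=
        lintegral_mono fun x => ENNReal.ofReal_le_ofReal (hb x)
    _ = ENNReal.ofReal (∫ x, (Real.cosh θ - C * s ^ 2 + Real.sinh θ / s) * g x +
      (-(Real.sinh θ / s)) + (Real.sinh θ / s + C) * (g x - 1) ^ 2 ∂Q) := by
        rw [ofReal_integral_eq_lintegral_ofReal hint]
        exact .of_forall fun x => (Real.rpow_nonneg (hg0 x) _).trans (hb x)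
    _ ≤ _ := by
        apply ENNReal.ofReal_le_ofReal
        have hi' : Integrable (fun x => (Real.cosh θ - C * s ^ 2 + Real.sinh θ / s) * g x +
            (-(Real.sinh θ / s))) Q := (hi.const_mul _).add (integrable_const _)
        rw [integral_add hi' (hi2.const_mul _),
          integral_add (hi.const_mul _) (integrable_const _), integral_const_mul,
          integral_const_mul, integral_const]
        refine le_trans ?_ (cosh_add_mul_sinh_le hs.le hθ0.le)
        have e : Real.sinh θ / s * s ^ 2 = s * Real.sinh θ := by field_simp
        simp only [probReal_univ, smul_eq_mul, one_mul]
        nlinarith [mul_le_mul_of_nonneg_left h1 (add_nonneg hC1 h5),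
          mul_le_mul_of_nonneg_left h2 (add_nonneg h5 hC0)]

/-- Moment bound for the truncated density ratio of two mixtures that differ in one component of
weight `1 / N`; `A` and `B` are the densities of the two components. -/
lemma truncated_mixture_moments {X : Type*} [MeasurableSpace X] {Q : Measure X}
    [IsProbabilityMeasure Q] {A B : X → ℝ} {N V lam : ℝ} (hN : 0 < N) (hlam : 0 < lam)
    (hA : Measurable A) (hB : Measurable B) (hA0 : ∀ x, 0 ≤ A x) (hB0 : ∀ x, 0 ≤ B x)
    (hBN : ∀ x, B x ≤ N)
    (hA1 : ∫⁻ x, ENNReal.ofReal (A x) ∂Q = 1) (hB1 : ∫⁻ x, ENNReal.ofReal (B x) ∂Q = 1)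
    (hA2 : ∫⁻ x, ENNReal.ofReal (A x ^ 2) ∂Q ≤ ENNReal.ofReal V)
    (hB2 : ∫⁻ x, ENNReal.ofReal (B x ^ 2) ∂Q ≤ ENNReal.ofReal V) (hV0 : 0 ≤ V)
    (hV : 2 * V ≤ Real.exp 1 ^ 2) :
    ∫⁻ x, ENNReal.ofReal (1 + (min (A x) (Real.exp 1) - B x) / N) ∂Q ≤ 1 ∧
    ∫⁻ x, ENNReal.ofReal (1 + (min (A x) (Real.exp 1) - B x) / N) ^ (1 + lam) ∂Q ≤
      ENNReal.ofReal (Real.exp (lam * (Real.exp 1 / N) * (Real.exp 1 / N) +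
        (lam * (Real.exp 1 / N)) ^ 2 / 2)) := by
  have lp : ∀ F : X → ℝ, Measurable F → (∀ x, 0 ≤ F x) →
      ∫⁻ x, ENNReal.ofReal (F x ^ 2) ∂Q ≤ ENNReal.ofReal V → MemLp F 2 Q ∧ ∫ x, F x ^ 2 ∂Q ≤ V := by
    intro F hF hF0 h
    have hint : Integrable (fun x => F x ^ 2) Q := by
      refine ⟨by fun_prop, ?_⟩
      rw [hasFiniteIntegral_iff_ofReal (.of_forall fun x => sq_nonneg _)]
      exact h.trans_lt ENNReal.ofReal_lt_top
    refine ⟨(memLp_two_iff_integrable_sq hF.aestronglyMeasurable).2 hint, ?_⟩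
    rw [integral_eq_lintegral_of_nonneg_ae (.of_forall fun x => sq_nonneg _) (by fun_prop)]
    exact ENNReal.toReal_le_of_le_ofReal hV0 h
  have int1 : ∀ F : X → ℝ, Measurable F → (∀ x, 0 ≤ F x) →
      ∫⁻ x, ENNReal.ofReal (F x) ∂Q = 1 → ∫ x, F x ∂Q = 1 := by
    intro F hF hF0 h
    rw [integral_eq_lintegral_of_nonneg_ae (.of_forall fun x => hF0 x) (by fun_prop), h]
    simp
  obtain ⟨hAlp, hAi2⟩ := lp A hA hA0 hA2
  obtain ⟨hBlp, hBi2⟩ := lp B hB hB0 hB2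
  have hA1' := int1 A hA hA0 hA1
  have hB1' := int1 B hB hB0 hB1
  have he := Real.exp_pos 1
  have hMlp : MemLp (fun x => min (A x) (Real.exp 1)) 2 Q :=
    hAlp.mono (by fun_prop) (.of_forall fun x => by
      rw [Real.norm_of_nonneg (le_min (hA0 x) he.le), Real.norm_of_nonneg (hA0 x)]
      exact min_le_left _ _)
  set g : X → ℝ := fun x => 1 + (min (A x) (Real.exp 1) - B x) / N with hg
  have hglp : MemLp g 2 Q := by
    have := (memLp_const (μ := Q) (p := 2) (1 : ℝ)).add ((hMlp.sub hBlp).const_mul N⁻¹)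
    refine this.ae_eq (.of_forall fun x => ?_)
    simp [hg, div_eq_inv_mul]
  -- `B ≤ N` holds because the component has weight `1 / N` in the reference mixture.
  have hg0 : ∀ x, 0 ≤ g x := by
    intro x
    have h1 : 0 ≤ min (A x) (Real.exp 1) := le_min (hA0 x) he.le
    have : g x = (N - B x + min (A x) (Real.exp 1)) / N := by
      simp only [hg]; field_simp; ring
    rw [this]
    apply div_nonneg _ hN.le
    linarith [hBN x]
  have hgs : ∀ x, g x ≤ 1 + Real.exp 1 / N := by
    intro x
    simp only [hg]
    gcongr
    linarith [hB0 x, min_le_right (A x) (Real.exp 1)]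
  have hg1 : ∫ x, g x ∂Q ≤ 1 := by
    simp only [hg]
    have hi' : Integrable (fun x => (min (A x) (Real.exp 1) - B x) / N) Q :=
      ((hMlp.integrable one_le_two).sub (hBlp.integrable one_le_two)).div_const _
    rw [integral_add (integrable_const _) hi', integral_div,
      integral_sub (hMlp.integrable one_le_two) (hBlp.integrable one_le_two), hB1']
    have : ∫ x, min (A x) (Real.exp 1) ∂Q ≤ 1 := by
      refine le_of_le_of_eq ?_ hA1'
      exact integral_mono (hMlp.integrable one_le_two) (hAlp.integrable one_le_two)
        fun x => min_le_left _ _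
    have := div_nonpos_of_nonpos_of_nonneg (sub_nonpos.2 this) hN.le
    simpa using this
  have hg2 : ∫ x, (g x - 1) ^ 2 ∂Q ≤ (Real.exp 1 / N) ^ 2 := by
    have hint : Integrable (fun x => (A x ^ 2 + B x ^ 2) / N ^ 2) Q :=
      (hAlp.integrable_sq.add hBlp.integrable_sq).div_const _
    have hint2 := (hglp.sub (memLp_const 1)).integrable_sq
    calc ∫ x, (g x - 1) ^ 2 ∂Q ≤ ∫ x, (A x ^ 2 + B x ^ 2) / N ^ 2 ∂Q := by
          refine integral_mono hint2 hint fun x => ?_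
          have : g x - 1 = (min (A x) (Real.exp 1) - B x) / N := by simp [hg]
          change (g x - 1) ^ 2 ≤ _
          rw [this, div_pow]
          gcongr
          have h1 : 0 ≤ min (A x) (Real.exp 1) := le_min (hA0 x) he.le
          have h2 := min_le_left (A x) (Real.exp 1)
          nlinarith [hB0 x, mul_nonneg h1 (hB0 x)]
      _ ≤ _ := by
          rw [integral_div, integral_add hAlp.integrable_sq hBlp.integrable_sq, div_pow]
          gcongr
          linarith
  refine ⟨?_, le_trans (le_of_eq ?_)
    (integral_rpow_one_add_le (by positivity) hlam hglp hg0 hgs hg1 hg2)⟩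
  swap
  · exact lintegral_congr fun x => ENNReal.ofReal_rpow_of_nonneg (hg0 x) (by positivity)
  rw [← ofReal_integral_eq_lintegral_ofReal (hglp.integrable one_le_two) (.of_forall hg0)]
  simpa using ENNReal.ofReal_le_ofReal hg1

/-! ### Comparison of two Gaussian mixtures. -/

noncomputable section

/-- Density of the uniform mixture of the `N(m i, v I)` with respect to `N(0, v I)`. -/
def mixtureRatio {n d : ℕ} (v : ℝ) (m : Fin n → EuclideanSpace ℝ (Fin d))
    (x : EuclideanSpace ℝ (Fin d)) : ℝ :=
  (∑ i, gaussianRatio v (m i) x) / n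

/-- The uniform mixture of the `N(m i, v I)`. -/
def gaussianMixture {n d : ℕ} (v : ℝ) (m : Fin n → EuclideanSpace ℝ (Fin d)) :
    Measure (EuclideanSpace ℝ (Fin d)) :=
  ∑ i : Fin n, (n : ℝ≥0∞)⁻¹ • isoGaussian (m i) v

/-- Ratio of the densities of two mixtures, where the part of the component `m j` that exceeds
`e` times the second mixture is removed. -/
def truncatedRatio {n d : ℕ} (v : ℝ) (m m' : Fin n → EuclideanSpace ℝ (Fin d)) (j : Fin n)
    (x : EuclideanSpace ℝ (Fin d)) : ℝ :=
  1 + (min (gaussianRatio v (m j) x / mixtureRatio v m' x) (Real.exp 1) -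
    gaussianRatio v (m' j) x / mixtureRatio v m' x) / n

variable {n d : ℕ} {v : ℝ} {m m' : Fin n → EuclideanSpace ℝ (Fin d)}

lemma measurable_mixtureRatio (v : ℝ) (m : Fin n → EuclideanSpace ℝ (Fin d)) :
    Measurable (mixtureRatio v m) := by
  unfold mixtureRatio
  fun_prop

lemma Measurable.truncatedRatio {X : Type*} [MeasurableSpace X] (v : ℝ)
    {m m' : X → Fin n → EuclideanSpace ℝ (Fin d)} (j : Fin n)
    {g : X → EuclideanSpace ℝ (Fin d)} (hm : ∀ i, Measurable fun x => m x i)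
    (hm' : ∀ i, Measurable fun x => m' x i) (hg : Measurable g) :
    Measurable fun x => truncatedRatio v (m x) (m' x) j (g x) := by
  unfold _root_.truncatedRatio mixtureRatio
  fun_prop

lemma mixtureRatio_pos [NeZero n] (v : ℝ) (m : Fin n → EuclideanSpace ℝ (Fin d))
    (x : EuclideanSpace ℝ (Fin d)) : 0 < mixtureRatio v m x := by
  have : 0 < n := NeZero.pos n
  have : Nonempty (Fin n) := ⟨0⟩
  refine div_pos (Finset.sum_pos (fun i _ => gaussianRatio_pos _ _ _) Finset.univ_nonempty) ?_
  exact_mod_cast NeZero.pos n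

instance [NeZero n] : IsProbabilityMeasure (gaussianMixture v m) := ⟨by
  simp [gaussianMixture, ENNReal.mul_inv_cancel (Nat.cast_ne_zero.2 (NeZero.ne n))
    (ENNReal.natCast_ne_top n)]⟩

lemma lintegral_gaussianMixture [NeZero n] (hv : 0 < v) {F : EuclideanSpace ℝ (Fin d) → ℝ≥0∞}
    (hF : Measurable F) :
    ∫⁻ x, F x ∂(gaussianMixture v m) =
      ∫⁻ x, ENNReal.ofReal (mixtureRatio v m x) * F x ∂(isoGaussian 0 v) := by
  have hn : (0 : ℝ) < n := by exact_mod_cast NeZero.pos n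
  have h : ∀ x, ENNReal.ofReal (mixtureRatio v m x) * F x =
      ∑ i, (n : ℝ≥0∞)⁻¹ * (ENNReal.ofReal (gaussianRatio v (m i) x) * F x) := by
    intro x
    rw [mixtureRatio, div_eq_inv_mul, ENNReal.ofReal_mul (by positivity),
      ENNReal.ofReal_sum_of_nonneg fun i _ => (gaussianRatio_pos _ _ _).le,
      ENNReal.ofReal_inv_of_pos hn, ENNReal.ofReal_natCast, mul_assoc, Finset.sum_mul,
      Finset.mul_sum]
  simp_rw [h]
  rw [lintegral_finsetSum _ (by fun_prop), gaussianMixture, lintegral_finsetSum_measure]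
  refine Finset.sum_congr rfl fun i _ => ?_
  rw [lintegral_smul_measure, lintegral_const_mul _ (by fun_prop),
    isoGaussian_eq_withDensity hv (m i),
    lintegral_withDensity_eq_lintegral_mul _ (by fun_prop) hF]
  rfl

lemma lintegral_gaussianRatio (hv : 0 < v) (m : EuclideanSpace ℝ (Fin d)) :
    ∫⁻ x, ENNReal.ofReal (gaussianRatio v m x) ∂(isoGaussian 0 v) = 1 := by
  simpa using lintegral_gaussianRatio_rpow hv m 0 0

/-- The harmonic mean is at most the arithmetic mean. This reduces second moments relative to a
mixture to pairs of Gaussians. -/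
lemma inv_mixtureRatio_le [NeZero n] (x : EuclideanSpace ℝ (Fin d)) :
    (mixtureRatio v m x)⁻¹ ≤ (∑ i, gaussianRatio v (m i) x ^ (-1 : ℝ)) / n := by
  have hn : (0 : ℝ) < n := by exact_mod_cast NeZero.pos n
  have h := Finset.sum_sq_le_sum_mul_sum_of_sq_le_mul (Finset.univ : Finset (Fin n))
    (r := fun _ => (1 : ℝ)) (f := fun i => gaussianRatio v (m i) x)
    (g := fun i => gaussianRatio v (m i) x ^ (-1 : ℝ))
    (fun i _ => (gaussianRatio_pos _ _ _).le)
    (fun i _ => Real.rpow_nonneg (gaussianRatio_pos _ _ _).le _)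
    (fun i _ => by rw [Real.rpow_neg_one, mul_inv_cancel₀ (gaussianRatio_pos _ _ _).ne', one_pow])
  have hq := mixtureRatio_pos v m x
  rw [inv_le_iff_one_le_mul₀ hq, mixtureRatio, div_mul_div_comm, one_le_div (by positivity)]
  simp at h
  nlinarith

lemma lintegral_mixture_ratio [NeZero n] (hv : 0 < v) (m' : Fin n → EuclideanSpace ℝ (Fin d))
    (c : EuclideanSpace ℝ (Fin d)) :
    ∫⁻ x, ENNReal.ofReal (gaussianRatio v c x / mixtureRatio v m' x) ∂(gaussianMixture v m') = 1 := by
  have := measurable_mixtureRatio v m'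
  rw [lintegral_gaussianMixture hv (by fun_prop), ← lintegral_gaussianRatio hv c]
  refine lintegral_congr fun x => ?_
  have hq := mixtureRatio_pos v m' x
  rw [← ENNReal.ofReal_mul hq.le, mul_div_cancel₀ _ hq.ne']

lemma lintegral_average_le [NeZero n] {X : Type*} [MeasurableSpace X] {μ : Measure X}
    {F : Fin n → X → ℝ} {C : ℝ} (hC : 0 ≤ C) (hF : ∀ i, Measurable (F i))
    (hF0 : ∀ i x, 0 ≤ F i x)
    (h : ∀ i, ∫⁻ x, ENNReal.ofReal (F i x) ∂μ ≤ ENNReal.ofReal C) :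
    ∫⁻ x, ENNReal.ofReal ((∑ i, F i x) / n) ∂μ ≤ ENNReal.ofReal C := by
  have hn : (0 : ℝ) < n := by exact_mod_cast NeZero.pos n
  simp_rw [div_eq_mul_inv, ENNReal.ofReal_mul' (inv_nonneg.2 hn.le),
    ENNReal.ofReal_sum_of_nonneg fun i _ => hF0 i _]
  rw [lintegral_mul_const _ (by fun_prop), lintegral_finsetSum _ (by fun_prop)]
  calc (∑ i, ∫⁻ x, ENNReal.ofReal (F i x) ∂μ) * ENNReal.ofReal (n : ℝ)⁻¹
      ≤ (∑ i : Fin n, ENNReal.ofReal C) * ENNReal.ofReal (n : ℝ)⁻¹ := by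
        gcongr with i; exact h i
    _ = ENNReal.ofReal C := by
        rw [← ENNReal.ofReal_sum_of_nonneg fun i _ => hC, ← ENNReal.ofReal_mul' (inv_nonneg.2 hn.le)]
        congr 1
        simp
        field_simp

lemma lintegral_mixture_ratio_sq_le [NeZero n] (hv : 0 < v) {c : EuclideanSpace ℝ (Fin d)} {V : ℝ}
    (hV : 0 ≤ V) (hc : ∀ i, Real.exp (‖c - m' i‖ ^ 2 / v) ≤ V) :
    ∫⁻ x, ENNReal.ofReal ((gaussianRatio v c x / mixtureRatio v m' x) ^ 2) ∂(gaussianMixture v m') ≤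
      ENNReal.ofReal V := by
  have := measurable_mixtureRatio v m'
  rw [lintegral_gaussianMixture hv (by fun_prop)]
  refine le_trans (lintegral_mono fun x => ?_) (lintegral_average_le (n := n) hV
    (F := fun i x => gaussianRatio v c x ^ ((1 : ℝ) + 1) * gaussianRatio v (m' i) x ^ (-1 : ℝ))
    (fun i => by fun_prop) (fun i x => mul_nonneg (Real.rpow_nonneg (gaussianRatio_pos _ _ _).le _)
      (Real.rpow_nonneg (gaussianRatio_pos _ _ _).le _)) fun i => ?_)
  · have hq := mixtureRatio_pos v m' x
    rw [← ENNReal.ofReal_mul hq.le]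
    apply ENNReal.ofReal_le_ofReal
    rw [← Finset.mul_sum, mul_div_assoc]
    have e : mixtureRatio v m' x * (gaussianRatio v c x / mixtureRatio v m' x) ^ 2 =
      gaussianRatio v c x ^ 2 * (mixtureRatio v m' x)⁻¹ := by field_simp
    rw [e, one_add_one_eq_two, Real.rpow_two]
    exact mul_le_mul_of_nonneg_left (inv_mixtureRatio_le x) (sq_nonneg _)
  · rw [lintegral_gaussianRatio_rpow hv]
    apply ENNReal.ofReal_le_ofReal
    refine le_trans (le_of_eq ?_) (hc i)
    congr 1
    field_simp
    ring

/-- Bernoulli's inequality for `(a / (e b)) ^ (k + 1)`. It replaces the excess over `e b` by a Rényi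
integrand, computable for Gaussians. -/
lemma sub_exp_mul_le {a b k : ℝ} (ha : 0 < a) (hb : 0 < b) (hk : 0 ≤ k) :
    a - Real.exp 1 * b ≤ Real.exp (-k) / (k + 1) * (a ^ (k + 1) * b ^ (-k)) := by
  have he := Real.exp_pos 1
  have h := one_add_mul_self_le_rpow_one_add (s := a / (Real.exp 1 * b) - 1)
    (by have : 0 ≤ a / (Real.exp 1 * b) := by positivity
        linarith) (p := k + 1) (by linarith)
  have e1 : 1 + (a / (Real.exp 1 * b) - 1) = a / (Real.exp 1 * b) := by ring
  rw [e1, Real.div_rpow ha.le (by positivity), Real.mul_rpow he.le hb.le, Real.rpow_add he,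
    Real.rpow_add hb, ← Real.exp_mul, one_mul, Real.rpow_one, Real.rpow_one] at h
  rw [Real.rpow_neg hb.le, Real.exp_neg]
  have hbk : 0 < b ^ k := Real.rpow_pos_of_pos hb k
  have hek := Real.exp_pos k
  have h2 := mul_le_mul_of_nonneg_left h (show 0 ≤ Real.exp 1 * b by positivity)
  have e2 : Real.exp 1 * b * (a ^ (k + 1) / (Real.exp k * Real.exp 1 * (b ^ k * b))) =
      a ^ (k + 1) * (Real.exp k)⁻¹ * (b ^ k)⁻¹ := by field_simp
  have e3 : Real.exp 1 * b * (1 + (k + 1) * (a / (Real.exp 1 * b) - 1)) =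
      Real.exp 1 * b + (k + 1) * (a - Real.exp 1 * b) := by field_simp
  rw [e2, e3] at h2
  have e4 : (Real.exp k)⁻¹ / (k + 1) * (a ^ (k + 1) * (b ^ k)⁻¹) =
    (a ^ (k + 1) * (Real.exp k)⁻¹ * (b ^ k)⁻¹) / (k + 1) := by ring
  rw [e4, le_div_iff₀ (by linarith)]
  nlinarith [mul_pos he hb]

/-- At order `k = 2L` the Rényi integral is at most `exp (L + 1/2)`, against the prefactor `exp
(-2L)`. The constant `5/4` is loose, chosen to match the `2.5` in the schedule. -/
lemma lintegral_excess_le (hv : 0 < v) {c c' : EuclideanSpace ℝ (Fin d)} {L : ℝ} (hL : 1 ≤ L)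
    (h : 2 * L * ‖c - c'‖ ^ 2 ≤ v) :
    ∫⁻ x, ENNReal.ofReal (Real.exp (-(2 * L)) / (2 * L + 1) *
      (gaussianRatio v c x ^ (2 * L + 1) * gaussianRatio v c' x ^ (-(2 * L)))) ∂(isoGaussian 0 v)
    ≤ ENNReal.ofReal (5 / 4 * Real.exp (-L)) := by
  have h0 : 0 ≤ Real.exp (-(2 * L)) / (2 * L + 1) := by positivity
  simp_rw [ENNReal.ofReal_mul h0]
  rw [lintegral_const_mul _ (by fun_prop), lintegral_gaussianRatio_rpow hv,
    ← ENNReal.ofReal_mul h0]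
  apply ENNReal.ofReal_le_ofReal
  have h1 : 2 * L * (2 * L + 1) * ‖c - c'‖ ^ 2 / (2 * v) ≤ L + 1 / 2 := by
    rw [div_le_iff₀ (by positivity)]
    nlinarith
  have h2 : Real.exp (1 / 2) ≤ 2 := by
    have : Real.exp (1 / 2) * Real.exp (1 / 2) = Real.exp 1 := by rw [← Real.exp_add]; norm_num
    nlinarith [Real.exp_one_lt_d9, Real.exp_pos (1 / 2)]
  calc Real.exp (-(2 * L)) / (2 * L + 1) * Real.exp (2 * L * (2 * L + 1) * ‖c - c'‖ ^ 2 / (2 * v))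
      ≤ Real.exp (-(2 * L)) / (2 * L + 1) * Real.exp (L + 1 / 2) := by gcongr
    _ = Real.exp (1 / 2) / (2 * L + 1) * Real.exp (-L) := by
        rw [div_mul_eq_mul_div, div_mul_eq_mul_div, ← Real.exp_add, ← Real.exp_add]
        congr 2; ring
    _ ≤ _ := by
        refine mul_le_mul_of_nonneg_right ?_ (Real.exp_pos _).le
        rw [div_le_iff₀ (by linarith)]
        linarith

lemma mixtureRatio_le [NeZero n] {j : Fin n} (hm : ∀ i, i ≠ j → m i = m' i) {k : ℝ} (hk : 0 ≤ k)
    (x : EuclideanSpace ℝ (Fin d)) :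
    mixtureRatio v m x ≤ mixtureRatio v m' x * truncatedRatio v m m' j x +
      (n : ℝ)⁻¹ * ((∑ i, Real.exp (-k) / (k + 1) *
        (gaussianRatio v (m j) x ^ (k + 1) * gaussianRatio v (m' i) x ^ (-k))) / n) := by
  have hn : (0 : ℝ) < n := by exact_mod_cast NeZero.pos n
  have hq := mixtureRatio_pos v m' x
  have ha := gaussianRatio_pos v (m j) x
  set R := (∑ i, Real.exp (-k) / (k + 1) *
        (gaussianRatio v (m j) x ^ (k + 1) * gaussianRatio v (m' i) x ^ (-k))) / n with hR
  have hR0 : 0 ≤ R := by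
    refine div_nonneg (Finset.sum_nonneg fun i _ => ?_) hn.le
    have := (gaussianRatio_pos v (m' i) x)
    positivity
  have h1 : mixtureRatio v m x = mixtureRatio v m' x +
      (gaussianRatio v (m j) x - gaussianRatio v (m' j) x) / n := by
    rw [mixtureRatio, mixtureRatio, ← Finset.add_sum_erase _ _ (Finset.mem_univ j),
      ← Finset.add_sum_erase _ (fun i => gaussianRatio v (m' i) x) (Finset.mem_univ j),
      Finset.sum_congr rfl fun i hi => by rw [hm i (Finset.ne_of_mem_erase hi)]]
    ring
  -- The excess over `e` times a mixture is the average of the excesses over its components.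
  have h2 : gaussianRatio v (m j) x - Real.exp 1 * mixtureRatio v m' x ≤ R := by
    have : gaussianRatio v (m j) x - Real.exp 1 * mixtureRatio v m' x =
        (∑ i, (gaussianRatio v (m j) x - Real.exp 1 * gaussianRatio v (m' i) x)) / n := by
      rw [Finset.sum_sub_distrib, ← Finset.mul_sum, mixtureRatio]
      simp
      field_simp
    rw [this, hR]
    gcongr with i
    exact sub_exp_mul_le ha (gaussianRatio_pos _ _ _) hk
  have h3 : gaussianRatio v (m j) x ≤ mixtureRatio v m' x *
      min (gaussianRatio v (m j) x / mixtureRatio v m' x) (Real.exp 1) + R := by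
    rw [mul_min_of_nonneg _ _ hq.le, mul_div_cancel₀ _ hq.ne']
    rcases min_cases (gaussianRatio v (m j) x) (mixtureRatio v m' x * Real.exp 1) with h | h <;>
      rw [h.1] <;> linarith
  have h4 : mixtureRatio v m' x * truncatedRatio v m m' j x = mixtureRatio v m' x +
      (mixtureRatio v m' x * min (gaussianRatio v (m j) x / mixtureRatio v m' x) (Real.exp 1) -
        gaussianRatio v (m' j) x) / n := by
    rw [truncatedRatio]
    field_simp
  rw [h1, h4, add_assoc]
  gcongr
  rw [← div_eq_inv_mul, ← add_div]
  gcongr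
  linarith

/-- One-step comparison of two uniform Gaussian mixtures that differ in the component `j`. -/
theorem gaussianMixture_comparison [NeZero n] (hv : 0 < v) {j : Fin n}
    (hm : ∀ i, i ≠ j → m i = m' i) {L lam : ℝ} (hL : 1 ≤ L) (hlam : 0 < lam)
    (h : ∀ i, 2 * L * ‖m j - m' i‖ ^ 2 ≤ v) (h' : ∀ i, 2 * L * ‖m' j - m' i‖ ^ 2 ≤ v) :
    (∀ F : EuclideanSpace ℝ (Fin d) → ℝ≥0∞, Measurable F → (∀ x, F x ≤ 1) →
      ∫⁻ x, F x ∂(gaussianMixture v m) ≤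
        ∫⁻ x, F x * ENNReal.ofReal (truncatedRatio v m m' j x) ∂(gaussianMixture v m') +
          ENNReal.ofReal (5 / 4 * Real.exp (-L) / n)) ∧
    ∫⁻ x, ENNReal.ofReal (truncatedRatio v m m' j x) ∂(gaussianMixture v m') ≤ 1 ∧
    ∫⁻ x, ENNReal.ofReal (truncatedRatio v m m' j x) ^ (1 + lam) ∂(gaussianMixture v m') ≤
      ENNReal.ofReal (Real.exp (lam * (Real.exp 1 / n) * (Real.exp 1 / n) +
        (lam * (Real.exp 1 / n)) ^ 2 / 2)) := by
  have hn : (0 : ℝ) < n := by exact_mod_cast NeZero.pos n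
  have hmeas := measurable_mixtureRatio v m'
  constructor
  · intro F hF hF1
    have ht : Measurable (truncatedRatio v m m' j) :=
      Measurable.truncatedRatio (m := fun _ => m) (m' := fun _ => m') v j
        (fun i => measurable_const) (fun i => measurable_const) measurable_id
    rw [lintegral_gaussianMixture hv hF, lintegral_gaussianMixture hv (by fun_prop)]
    set R : EuclideanSpace ℝ (Fin d) → ℝ := fun x =>
      (∑ i, Real.exp (-(2 * L)) / (2 * L + 1) * (gaussianRatio v (m j) x ^ (2 * L + 1) *
        gaussianRatio v (m' i) x ^ (-(2 * L)))) / n with hR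
    have hRm : Measurable R := by fun_prop
    have hRi : ∫⁻ x, ENNReal.ofReal (R x) ∂(isoGaussian 0 v) ≤
        ENNReal.ofReal (5 / 4 * Real.exp (-L)) :=
      lintegral_average_le (by positivity) (fun i => by fun_prop) (fun i x => by
        have := gaussianRatio_pos v (m j) x
        have := gaussianRatio_pos v (m' i) x
        positivity) fun i => lintegral_excess_le hv hL (h i)
    calc ∫⁻ x, ENNReal.ofReal (mixtureRatio v m x) * F x ∂(isoGaussian 0 v)
        ≤ ∫⁻ x, (ENNReal.ofReal (mixtureRatio v m' x) *
            (F x * ENNReal.ofReal (truncatedRatio v m m' j x)) +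
            ENNReal.ofReal (n : ℝ)⁻¹ * ENNReal.ofReal (R x)) ∂(isoGaussian 0 v) := by
          refine lintegral_mono fun x => ?_
          have hq := mixtureRatio_pos v m' x
          calc ENNReal.ofReal (mixtureRatio v m x) * F x
              ≤ (ENNReal.ofReal (mixtureRatio v m' x) *
                ENNReal.ofReal (truncatedRatio v m m' j x) +
                ENNReal.ofReal (n : ℝ)⁻¹ * ENNReal.ofReal (R x)) * F x := by
                gcongr
                rw [← ENNReal.ofReal_mul hq.le, ← ENNReal.ofReal_mul (by positivity)]
                exact (ENNReal.ofReal_le_ofReal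
                  (mixtureRatio_le hm (by linarith : (0 : ℝ) ≤ 2 * L) x)).trans
                  ENNReal.ofReal_add_le
            _ ≤ _ := by
                rw [add_mul]
                exact add_le_add (le_of_eq (by ring)) (mul_le_of_le_one_right' (hF1 x))
      _ ≤ _ := by
          rw [lintegral_add_right _ (by fun_prop), lintegral_const_mul _ (by fun_prop)]
          gcongr
          rw [div_eq_inv_mul, ENNReal.ofReal_mul (by positivity)]
          gcongr
  · have hbound : ∀ c : EuclideanSpace ℝ (Fin d), (∀ i, 2 * L * ‖c - m' i‖ ^ 2 ≤ v) →
        ∀ i, Real.exp (‖c - m' i‖ ^ 2 / v) ≤ 2 := by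
      intro c hc i
      have h1 : ‖c - m' i‖ ^ 2 / v ≤ 1 / 2 := by
        rw [div_le_iff₀ hv]
        nlinarith [hc i, sq_nonneg ‖c - m' i‖]
      refine (Real.exp_le_exp.2 h1).trans ?_
      have : Real.exp (1 / 2) * Real.exp (1 / 2) = Real.exp 1 := by rw [← Real.exp_add]; norm_num
      nlinarith [Real.exp_one_lt_d9, Real.exp_pos (1 / 2)]
    refine truncated_mixture_moments (V := 2) hn hlam (by fun_prop) (by fun_prop)
      (fun x => ?_) (fun x => ?_) (fun x => ?_) (lintegral_mixture_ratio hv _ _)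
      (lintegral_mixture_ratio hv _ _) (lintegral_mixture_ratio_sq_le hv two_pos.le (hbound _ h))
      (lintegral_mixture_ratio_sq_le hv two_pos.le (hbound _ h')) two_pos.le ?_
    · exact div_nonneg (gaussianRatio_pos _ _ _).le (mixtureRatio_pos _ _ _).le
    · exact div_nonneg (gaussianRatio_pos _ _ _).le (mixtureRatio_pos _ _ _).le
    · rw [div_le_iff₀ (mixtureRatio_pos _ _ _), mixtureRatio, mul_div_cancel₀ _ hn.ne']
      exact Finset.single_le_sum (f := fun i => gaussianRatio v (m' i) x)
        (fun i _ => (gaussianRatio_pos _ _ _).le) (Finset.mem_univ j)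
    · nlinarith [Real.add_one_le_exp (1 : ℝ)]

end

/-! ### Composition over steps and the tail bound. -/

/-- Composition of approximate density bounds. -/
lemma lintegral_compProd_comparison {X Y : Type*} [MeasurableSpace X] [MeasurableSpace Y]
    {μ ν : Measure X} [IsProbabilityMeasure μ] [SFinite ν] {K K' : Kernel X Y}
    [IsMarkovKernel K] [IsMarkovKernel K'] {f : X → ℝ≥0∞} {g : X × Y → ℝ≥0∞}
    (hf : Measurable f) (hg : Measurable g) {D D' : ℝ≥0∞}
    (hμ : ∀ F : X → ℝ≥0∞, Measurable F → (∀ x, F x ≤ 1) →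
      ∫⁻ x, F x ∂μ ≤ ∫⁻ x, F x * f x ∂ν + D)
    (hK : ∀ x, ∀ F : Y → ℝ≥0∞, Measurable F → (∀ y, F y ≤ 1) →
      ∫⁻ y, F y ∂(K x) ≤ ∫⁻ y, F y * g (x, y) ∂(K' x) + D')
    (hg1 : ∀ x, ∫⁻ y, g (x, y) ∂(K' x) ≤ 1)
    {F : X × Y → ℝ≥0∞} (hF : Measurable F) (hF1 : ∀ p, F p ≤ 1) :
    ∫⁻ p, F p ∂(μ ⊗ₘ K) ≤ ∫⁻ p, F p * (f p.1 * g p) ∂(ν ⊗ₘ K') + (D + D') := by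
  rw [Measure.lintegral_compProd hF, Measure.lintegral_compProd (by fun_prop)]
  have hm : Measurable fun x => ∫⁻ y, F (x, y) * g (x, y) ∂(K' x) :=
    (hF.mul hg).lintegral_kernel_prod_right'
  calc ∫⁻ x, ∫⁻ y, F (x, y) ∂(K x) ∂μ
      ≤ ∫⁻ x, (∫⁻ y, F (x, y) * g (x, y) ∂(K' x) + D') ∂μ :=
        lintegral_mono fun x => hK x _ (by fun_prop) fun y => hF1 _
    _ = ∫⁻ x, ∫⁻ y, F (x, y) * g (x, y) ∂(K' x) ∂μ + D' := by
        rw [lintegral_add_right _ measurable_const]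
        simp
    _ ≤ ∫⁻ x, (∫⁻ y, F (x, y) * g (x, y) ∂(K' x)) * f x ∂ν + D + D' := by
        gcongr
        -- Test functions bounded by `1`, rather than sets, let the inner integral serve as a test
        -- function; this needs `hg1`.
        exact hμ _ hm fun x => (lintegral_mono fun y => mul_le_of_le_one_left' (hF1 _)).trans (hg1 x)
    _ = _ := by
        rw [add_assoc]
        congr 1
        refine lintegral_congr fun x => ?_
        rw [← lintegral_mul_const _ (by fun_prop)]
        exact lintegral_congr fun y => by ring

lemma lintegral_compProd_rpow_le {X Y : Type*} [MeasurableSpace X] [MeasurableSpace Y]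
    {ν : Measure X} [SFinite ν] {K' : Kernel X Y} [IsMarkovKernel K'] {f : X → ℝ≥0∞}
    {g : X × Y → ℝ≥0∞} (hf : Measurable f) (hg : Measurable g) {M M' : ℝ≥0∞} {p : ℝ} (hp : 0 ≤ p)
    (hν : ∫⁻ x, f x ^ p ∂ν ≤ M) (hg2 : ∀ x, ∫⁻ y, g (x, y) ^ p ∂(K' x) ≤ M') :
    ∫⁻ q, (f q.1 * g q) ^ p ∂(ν ⊗ₘ K') ≤ M * M' := by
  rw [Measure.lintegral_compProd (by fun_prop)]
  simp_rw [ENNReal.mul_rpow_of_nonneg _ _ hp]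
  calc ∫⁻ x, ∫⁻ y, f x ^ p * g (x, y) ^ p ∂(K' x) ∂ν ≤ ∫⁻ x, f x ^ p * M' ∂ν := by
        refine lintegral_mono fun x => ?_
        rw [lintegral_const_mul _ (by fun_prop)]
        gcongr
        exact hg2 x
    _ ≤ M * M' := by
        rw [lintegral_mul_const _ (by fun_prop)]
        gcongr

/-- The density bound `f` is the product of the one-step bounds along the history. -/
lemma sgldLaw_comparison {Z : Type*} {n d : ℕ} [NeZero n] {ℓ : EuclideanSpace ℝ (Fin d) → Z → ℝ}
    {η lam : ℕ → ℝ} {β₀ p : ℝ} (hp : 0 ≤ p) {S S' : Fin n → Z} {D : ℕ → ℝ≥0∞} {M : ℝ≥0∞}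
    {g : (t : ℕ) → (Fin t → EuclideanSpace ℝ (Fin d)) × EuclideanSpace ℝ (Fin d) → ℝ≥0∞}
    (hg : ∀ t, Measurable (g t))
    (hstep : ∀ t h, ∀ F : EuclideanSpace ℝ (Fin d) → ℝ≥0∞, Measurable F → (∀ y, F y ≤ 1) →
      ∫⁻ y, F y ∂(sgldNext ℓ η lam β₀ S t h) ≤
        ∫⁻ y, F y * g t (h, y) ∂(sgldNext ℓ η lam β₀ S' t h) + D t)
    (hg1 : ∀ t h, ∫⁻ y, g t (h, y) ∂(sgldNext ℓ η lam β₀ S' t h) ≤ 1)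
    (hg2 : ∀ t h, ∫⁻ y, g t (h, y) ^ p ∂(sgldNext ℓ η lam β₀ S' t h) ≤ M) (T : ℕ) :
    ∃ f : (Fin T → EuclideanSpace ℝ (Fin d)) → ℝ≥0∞, Measurable f ∧
      (∀ F : (Fin T → EuclideanSpace ℝ (Fin d)) → ℝ≥0∞, Measurable F → (∀ x, F x ≤ 1) →
        ∫⁻ x, F x ∂(sgldLaw ℓ η lam β₀ T S) ≤
          ∫⁻ x, F x * f x ∂(sgldLaw ℓ η lam β₀ T S') + ∑ t ∈ Finset.range T, D t) ∧
      ∫⁻ x, f x ^ p ∂(sgldLaw ℓ η lam β₀ T S') ≤ M ^ T := by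
  induction T with
  | zero =>
    refine ⟨fun _ => 1, measurable_const, fun F hF hF1 => ?_, ?_⟩
    · simp [sgldLaw]
    · simp [sgldLaw]
  | succ t ih =>
    obtain ⟨f, hf, h1, h2⟩ := ih
    have hsnoc := measurable_fin_snoc (X := EuclideanSpace ℝ (Fin d)) t
    have hinit : Measurable fun x : Fin (t + 1) → EuclideanSpace ℝ (Fin d) =>
        ((fun i => x i.castSucc : Fin t → EuclideanSpace ℝ (Fin d)), x (Fin.last t)) := by
      fun_prop
    have hfg : Measurable fun x : Fin (t + 1) → EuclideanSpace ℝ (Fin d) =>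
        f (fun i => x i.castSucc) * g t (fun i => x i.castSucc, x (Fin.last t)) :=
      (hf.comp (measurable_fst.comp hinit)).mul ((hg t).comp hinit)
    refine ⟨_, hfg, fun F hF hF1 => ?_, ?_⟩
    · rw [sgldLaw, sgldLaw, lintegral_map hF hsnoc,
        lintegral_map (by fun_prop) hsnoc,
        Finset.sum_range_succ]
      simp only [Fin.snoc_castSucc, Fin.snoc_last]
      exact lintegral_compProd_comparison hf (hg t) h1 (hstep t) (hg1 t) (hF.comp hsnoc)
        fun p => hF1 _
    · rw [sgldLaw, lintegral_map (by fun_prop) hsnoc, pow_succ]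
      simp only [Fin.snoc_castSucc, Fin.snoc_last]
      exact lintegral_compProd_rpow_le hf (hg t) hp h2 (hg2 t)

lemma measure_le_of_moment_bound {Ω : Type*} [MeasurableSpace Ω] {μ ν : Measure Ω}
    [IsProbabilityMeasure μ] [IsProbabilityMeasure ν] {f : Ω → ℝ≥0∞} {a ε κ D : ℝ}
    (ha : 0 < a) (hκ : 0 ≤ κ) (hD : 0 ≤ D)
    (h : ∀ F : Ω → ℝ≥0∞, Measurable F → (∀ x, F x ≤ 1) →
      ∫⁻ x, F x ∂μ ≤ ∫⁻ x, F x * f x ∂ν + ENNReal.ofReal D) (hf : Measurable f)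
    (hmom : ∫⁻ x, f x ^ (1 + a) ∂ν ≤ ENNReal.ofReal κ) {s : Set Ω} (hs : MeasurableSet s) :
    μ.real s ≤ Real.exp ε * ν.real s + (Real.exp (-a * ε) * κ + D) := by
  set E := ENNReal.ofReal (Real.exp ε) with hE
  have hE0 : E ≠ 0 := by simp [hE, Real.exp_pos]
  have hEt : E ≠ ⊤ := ENNReal.ofReal_ne_top
  -- Markov's inequality in pointwise form: where `f > E`, `(f / E) ^ a ≥ 1`.
  have hpt : ∀ x, f x ≤ E + E ^ (-a) * f x ^ (1 + a) := by
    intro x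
    rcases le_total (f x) E with hx | hx
    · exact hx.trans le_self_add
    · refine le_trans ?_ le_add_self
      rw [ENNReal.rpow_add_of_nonneg _ _ zero_le_one ha.le, ENNReal.rpow_one, mul_left_comm]
      refine le_mul_of_one_le_right' ?_
      calc (1 : ℝ≥0∞) = E ^ (-a) * E ^ a := by
            rw [← ENNReal.rpow_add _ _ hE0 hEt]; simp
        _ ≤ E ^ (-a) * f x ^ a := by gcongr
  have h1 := h (s.indicator 1) (measurable_one.indicator hs) fun x =>
    Set.indicator_le_self' (fun _ _ => zero_le_one) x
  rw [lintegral_indicator_one hs] at h1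
  have h2 : ∫⁻ x, s.indicator 1 x * f x ∂ν ≤ E * ν s + E ^ (-a) * ENNReal.ofReal κ := by
    calc ∫⁻ x, s.indicator 1 x * f x ∂ν
        ≤ ∫⁻ x, (E * s.indicator 1 x + E ^ (-a) * f x ^ (1 + a)) ∂ν := by
          refine lintegral_mono fun x => ?_
          by_cases hx : x ∈ s
          · simpa [hx] using hpt x
          · simp [hx]
      _ ≤ _ := by
          rw [lintegral_add_right _ (by fun_prop), lintegral_const_mul _
            (measurable_one.indicator hs), lintegral_indicator_one hs,
            lintegral_const_mul _ (by fun_prop)]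
          gcongr
  have h3 : μ s ≤ ENNReal.ofReal (Real.exp ε * ν.real s + (Real.exp (-a * ε) * κ + D)) := by
    refine (h1.trans (add_le_add_left h2 _)).trans (le_of_eq ?_)
    rw [ENNReal.ofReal_add (by positivity) (by positivity), ENNReal.ofReal_add (by positivity) hD,
      ENNReal.ofReal_mul (by positivity), ENNReal.ofReal_mul (by positivity), ofReal_measureReal,
      hE, ENNReal.ofReal_rpow_of_pos (Real.exp_pos ε), ← Real.exp_mul, mul_comm ε, add_assoc]
  exact ENNReal.toReal_le_of_le_ofReal (by positivity) h3

/-! ### Error budget and step-size schedule. -/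

/-- Telescoping from `t = 1`; the term `t = 0` is a division by zero, hence `0`. -/
lemma sum_range_div_mul_succ_le {δ : ℝ} (hδ : 0 ≤ δ) (T : ℕ) :
    ∑ t ∈ Finset.range T, δ / (2 * (t * (t + 1))) ≤ δ / 2 := by
  have h : ∀ T : ℕ, ∑ t ∈ Finset.range (T + 1), δ / (2 * ((t : ℝ) * (t + 1))) =
      δ / 2 * (1 - 1 / (T + 1)) := by
    intro T
    induction T with
    | zero => simp
    | succ k ih =>
      rw [Finset.sum_range_succ, ih]
      push_cast
      field_simp
      ring
  rcases T with _ | T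
  · simpa using div_nonneg hδ two_pos.le
  · rw [h]
    have : 0 ≤ 1 / ((T : ℝ) + 1) := by positivity
    nlinarith

/-- The step-size schedule makes the noise large enough compared with the sensitivity. -/
lemma schedule_noise_bound {G β₀ a x η η' lam : ℝ} (hG : 0 < G) (hβ₀ : 0 < β₀) (ha : 0 < a)
    (ha' : a < 5 / 2) (hx : 2 ≤ x)
    (hη : η = G⁻¹ * √β₀ / √(8 * Real.log (2.5 * x ^ 2 / a) * x))
    (hη' : η' = G⁻¹ * √β₀ / √(8 * Real.log (2.5 * (x - 1) ^ 2 / a) * (x - 1)))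
    (hlam : lam = 1 / η - 1 / η') :
    1 ≤ Real.log (2.5 * x ^ 2 / a) ∧ 0 < lam * η * (2 - lam * η) * β₀ ∧
    2 * Real.log (2.5 * x ^ 2 / a) * ((1 - lam * η) ^ 2 * (η ^ 2 * (2 * G) ^ 2)) ≤
      lam * η * (2 - lam * η) * β₀ := by
  have hL1 : 1 ≤ Real.log (2.5 * x ^ 2 / a) := by
    rw [Real.le_log_iff_exp_le (by positivity), le_div_iff₀ ha]
    nlinarith [Real.exp_one_lt_d9, Real.exp_pos 1]
  have hL'0 : 0 < Real.log (2.5 * (x - 1) ^ 2 / a) := by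
    apply Real.log_pos
    rw [one_lt_div ha]
    nlinarith
  have hLL' : Real.log (2.5 * (x - 1) ^ 2 / a) ≤ Real.log (2.5 * x ^ 2 / a) := by
    apply Real.log_le_log
    · have : 0 < x - 1 := by linarith
      positivity
    · gcongr
      · linarith
      · linarith
  set L := Real.log (2.5 * x ^ 2 / a)
  set L' := Real.log (2.5 * (x - 1) ^ 2 / a)
  have hx1 : 0 < x - 1 := by linarith
  have hc : 0 < G⁻¹ * √β₀ := mul_pos (inv_pos.2 hG) (Real.sqrt_pos.2 hβ₀)
  have hη0 : 0 < η := by rw [hη]; positivity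
  have hη'0 : 0 < η' := by rw [hη']; positivity
  have hsq : η ^ 2 = β₀ / G ^ 2 / (8 * L * x) := by
    rw [hη, div_pow, mul_pow, Real.sq_sqrt hβ₀.le, Real.sq_sqrt (by positivity), inv_pow]
    field_simp
  have hsq' : η' ^ 2 = β₀ / G ^ 2 / (8 * L' * (x - 1)) := by
    rw [hη', div_pow, mul_pow, Real.sq_sqrt hβ₀.le, Real.sq_sqrt (by positivity), inv_pow]
    field_simp
  -- The choice of `lam` makes the contraction factor a ratio of successive step sizes.
  have hρ : 1 - lam * η = η / η' := by
    rw [hlam]; field_simp; ring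
  have hρ2 : (1 - lam * η) ^ 2 = L' * (x - 1) / (L * x) := by
    rw [hρ, div_pow, hsq, hsq']
    field_simp
  have hv : lam * η * (2 - lam * η) = 1 - (1 - lam * η) ^ 2 := by ring
  rw [hv, hρ2, hsq]
  have hLx : 0 < L * x := by positivity
  have e : 1 - L' * (x - 1) / (L * x) = (L * x - L' * (x - 1)) / (L * x) := by field_simp
  refine ⟨hL1, ?_, ?_⟩
  · rw [e]
    have : 0 < L * x - L' * (x - 1) := by nlinarith
    positivity
  · have e2 : 2 * L * (L' * (x - 1) / (L * x) * (β₀ / G ^ 2 / (8 * L * x) * (2 * G) ^ 2)) =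
        (L' * (x - 1) / x) / (L * x) * β₀ := by
      field_simp
      ring
    rw [e, e2]
    gcongr
    rw [div_le_iff₀ (by linarith)]
    have h1 : 0 ≤ (L - L') * (x ^ 2 - 1) :=
      mul_nonneg (sub_nonneg.2 hLL') (by nlinarith)
    nlinarith

section

variable {Z : Type*} {n d : ℕ} {ℓ : EuclideanSpace ℝ (Fin d) → Z → ℝ}

lemma norm_sgldMean_sub_sq_le {G : ℝ} (hgrad : ∀ w z, ‖gradient (fun u => ℓ u z) w‖ ≤ G)
    (η lam : ℝ) (w : EuclideanSpace ℝ (Fin d)) (z z' : Z) :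
    ‖(1 - lam * η) • (w - η • gradient (fun u => ℓ u z) w) -
      (1 - lam * η) • (w - η • gradient (fun u => ℓ u z') w)‖ ^ 2 ≤
      (1 - lam * η) ^ 2 * (η ^ 2 * (2 * G) ^ 2) := by
  rw [← smul_sub, sub_sub_sub_cancel_left, ← smul_sub, norm_smul, norm_smul, mul_pow, mul_pow,
    Real.norm_eq_abs, Real.norm_eq_abs, sq_abs, sq_abs]
  gcongr
  refine (norm_sub_le _ _).trans ?_
  linarith [hgrad w z, hgrad w z']

end

/-! ### Assembly and choice of the moment order. -/

theorem mainTheorem5 {Z : Type*} {n d : ℕ} [NeZero n] (T : ℕ)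
    (ℓ : EuclideanSpace ℝ (Fin d) → Z → ℝ) (G β₀ δ : ℝ)
    (hdiff : ∀ z, Differentiable ℝ (fun w => ℓ w z))
    (hG : 0 < G) (hgrad : ∀ w z, ‖gradient (fun u => ℓ u z) w‖ ≤ G)
    (hβ₀ : 0 < β₀) (hδ : 0 < δ) (hδ1 : δ ≤ 1) (hnδ : n * δ < 5 / 2)
    (η lam : ℕ → ℝ)
    (hη : ∀ t : ℕ, 1 ≤ t →
      η t = G⁻¹ * √β₀ / √(8 * Real.log (2.5 * (t : ℝ) ^ 2 / (n * δ)) * t))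
    (hlam : ∀ t : ℕ, 2 ≤ t → lam t = 1 / η t - 1 / η (t - 1)) :
    IsDP (fun S : Fin n → Z => sgldLaw ℓ η lam β₀ T S)
      (√(2 * T * Real.log (2 / δ)) * Real.exp 1 / n + T * Real.exp 1 ^ 2 / (n : ℝ) ^ 2) δ := by
  intro S S' hSS' F hF
  have hn : (0 : ℝ) < n := by exact_mod_cast NeZero.pos n
  rcases Nat.eq_zero_or_pos T with rfl | hT
  · simpa [sgldLaw] using hδ.le
  have hT' : (0 : ℝ) < T := by exact_mod_cast hT
  obtain ⟨j, hj⟩ : ∃ j, ∀ i, i ≠ j → S i = S' i := by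
    by_cases h : ∃ j, S j ≠ S' j
    · obtain ⟨j, hj⟩ := h
      exact ⟨j, fun i hi => by_contra fun hc => hi (hSS' hc hj)⟩
    · push Not at h
      exact ⟨0, fun i _ => h i⟩
  set s := Real.exp 1 / n with hs
  have hs0 : 0 < s := by positivity
  set Λ := Real.log (2 / δ) with hΛ
  have hΛ0 : 0 < Λ := Real.log_pos (by rw [one_lt_div hδ]; linarith)
  -- Minimizer of `T θ² / 2 - θ √(2 T Λ)`, the final exponent; `a * s = θ`.
  set θ := √(2 * Λ / T) with hθ
  have hθ0 : 0 < θ := Real.sqrt_pos.2 (by positivity)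
  set a := θ / s with ha
  have ha0 : 0 < a := by positivity
  have has : a * s = θ := by rw [ha]; field_simp
  let mean (S : Fin n → Z) (t : ℕ) (w : EuclideanSpace ℝ (Fin d)) (i : Fin n) :=
    (1 - lam t * η t) • (w - η t • gradient (fun u => ℓ u (S i)) w)
  let var (t : ℕ) := lam t * η t * (2 - lam t * η t) * β₀
  let g : (t : ℕ) → (Fin t → EuclideanSpace ℝ (Fin d)) × EuclideanSpace ℝ (Fin d) → ℝ≥0∞
    -- The first iterate does not depend on the data.
    | 0 => fun _ => 1
    | k + 1 => fun q => ENNReal.ofReal (truncatedRatio (var (k + 2))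
        (mean S (k + 2) (q.1 (Fin.last k))) (mean S' (k + 2) (q.1 (Fin.last k))) j q.2)
  have hmean : ∀ (S : Fin n → Z) t i, Measurable fun w => mean S t w i := fun S t i =>
    ((measurable_id.sub ((measurable_gradient _).const_smul (η t))).const_smul (1 - lam t * η t))
  have hgm : ∀ t, Measurable (g t) := by
    rintro (_ | k)
    · exact measurable_const
    · refine ENNReal.measurable_ofReal.comp (Measurable.truncatedRatio _ _ (fun i => ?_)
        (fun i => ?_) measurable_snd)
      · exact (hmean S _ i).comp (by fun_prop)
      · exact (hmean S' _ i).comp (by fun_prop)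
  have hcmp : ∀ (k : ℕ) (w : EuclideanSpace ℝ (Fin d)), _ := fun k w =>
    gaussianMixture_comparison (v := var (k + 2)) (m := mean S (k + 2) w) (m' := mean S' (k + 2) w)
      (j := j) (L := Real.log (2.5 * ((k + 2 : ℕ) : ℝ) ^ 2 / (n * δ))) (lam := a)
  have hsched : ∀ k : ℕ, _ := fun k => schedule_noise_bound hG hβ₀ (mul_pos hn hδ) hnδ
    (x := ((k + 2 : ℕ) : ℝ)) (by push_cast; linarith [k.cast_nonneg (α := ℝ)])
    (hη (k + 2) (by omega)) (η' := η (k + 1))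
    (by rw [hη (k + 1) (by omega)]; push_cast; ring_nf) (hlam (k + 2) (by omega))
  have hstep : ∀ (k : ℕ) (w : EuclideanSpace ℝ (Fin d)), _ := fun k w =>
    hcmp k w (hsched k).2.1 (fun i hi => by simp only [mean, hj i hi]) (hsched k).1 ha0
      (fun i => (mul_le_mul_of_nonneg_left (norm_sgldMean_sub_sq_le hgrad _ _ _ _ _)
        (by linarith [(hsched k).1])).trans (hsched k).2.2)
      (fun i => (mul_le_mul_of_nonneg_left (norm_sgldMean_sub_sq_le hgrad _ _ _ _ _)
        (by linarith [(hsched k).1])).trans (hsched k).2.2)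
  -- With `t = k + 2` the left side equals `δ / (2 t²)`, at most `δ / (2 t (t - 1))`.
  have hD : ∀ k : ℕ, 5 / 4 * Real.exp (-Real.log (2.5 * ((k + 2 : ℕ) : ℝ) ^ 2 / (n * δ))) / n ≤
      δ / (2 * (((k + 1 : ℕ) : ℝ) * ((k + 1 : ℕ) + 1))) := by
    intro k
    rw [Real.exp_neg, Real.exp_log (by positivity)]
    have e : 5 / 4 * (2.5 * ((k + 2 : ℕ) : ℝ) ^ 2 / (n * δ))⁻¹ / n =
      δ / (2 * ((k + 2 : ℕ) : ℝ) ^ 2) := by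
      field_simp
      norm_num
    rw [e]
    push_cast
    gcongr
    nlinarith [k.cast_nonneg (α := ℝ)]
  obtain ⟨f, hf, hf1, hf2⟩ := sgldLaw_comparison (ℓ := ℓ) (η := η) (lam := lam) (β₀ := β₀)
    (p := 1 + a) (by positivity) (S := S) (S' := S') (g := g)
    (D := fun t => ENNReal.ofReal (δ / (2 * (t * (t + 1)))))
    (M := ENNReal.ofReal (Real.exp (a * s * s + (a * s) ^ 2 / 2))) hgm
    (by
      rintro (_ | k) h H hH hH1
      · simp [g, sgldNext]
      -- The transition kernel at `h` is by definition the `gaussianMixture` with these means.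
      · refine ((hstep k (h (Fin.last k))).1 H hH hH1).trans ?_
        exact add_le_add le_rfl (ENNReal.ofReal_le_ofReal (hD k)))
    (by
      rintro (_ | k) h
      · simp [g]
      · exact (hstep k (h (Fin.last k))).2.1)
    (by
      rintro (_ | k) h
      · have : 0 ≤ a * s * s + (a * s) ^ 2 / 2 := by positivity
        simpa [g] using this
      · exact (hstep k (h (Fin.last k))).2.2) T
  rw [← ENNReal.ofReal_sum_of_nonneg fun t _ => by positivity] at hf1
  rw [← ENNReal.ofReal_pow (Real.exp_pos _).le] at hf2
  have hfin := measure_le_of_moment_bound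
    (ε := √(2 * T * Λ) * Real.exp 1 / n + T * Real.exp 1 ^ 2 / (n : ℝ) ^ 2)
    ha0 (by positivity) (Finset.sum_nonneg fun t _ => by positivity) hf1 hf hf2 hF
  refine hfin.trans ?_
  gcongr
  have hsum := sum_range_div_mul_succ_le hδ.le T
  have hexp : Real.exp (-a * (√(2 * T * Λ) * Real.exp 1 / n + T * Real.exp 1 ^ 2 / (n : ℝ) ^ 2)) *
      Real.exp (a * s * s + (a * s) ^ 2 / 2) ^ T = δ / 2 := by
    have e1 : √(2 * T * Λ) * Real.exp 1 / n + T * Real.exp 1 ^ 2 / (n : ℝ) ^ 2 =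
        √(2 * T * Λ) * s + T * s ^ 2 := by rw [hs]; ring
    have e2 : θ * √(2 * T * Λ) = 2 * Λ := by
      rw [hθ, ← Real.sqrt_mul (by positivity)]
      have : 2 * Λ / T * (2 * T * Λ) = (2 * Λ) ^ 2 := by field_simp
      rw [this, Real.sqrt_sq (by positivity)]
    have e3 : T * θ ^ 2 = 2 * Λ := by
      rw [hθ, Real.sq_sqrt (by positivity)]; field_simp
    rw [e1, ← Real.exp_nat_mul, ← Real.exp_add, has]
    have e4 : -a * (√(2 * T * Λ) * s + T * s ^ 2) + T * (θ * s + θ ^ 2 / 2) = -Λ := by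
      calc -a * (√(2 * T * Λ) * s + T * s ^ 2) + T * (θ * s + θ ^ 2 / 2)
          = -(a * s) * √(2 * T * Λ) - T * (a * s) * s + T * θ * s + T * θ ^ 2 / 2 := by ring
        _ = -(θ * √(2 * T * Λ)) + T * θ ^ 2 / 2 := by rw [has]; ring
        _ = -Λ := by rw [e2, e3]; ring
    rw [e4, hΛ, Real.exp_neg, Real.exp_log (by positivity), inv_div]
  rw [hexp]
  linarith
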